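/- **Setting.** Let $\mathbb X\subset\mathbb R^{p}$ and $\mathbb Y\subset\mathbb R^{q}$ be Borel sets (state and observation spaces) and let $\mathbb U$ be a nonempty subset of a Euclidean space (the action space). Let $P$ be a probability measure on $\mathbb X$ (the initial distribution), $Q$ a stochastic kernel from $\mathbb X$ to $\mathbb Y$ (the observation channel), $\mathcal T$ and $\mathcal T_n$ ($n\in\mathbb N$) stochastic kernels from $\mathbb X\times\mathbb U$ to $\mathbb X$ (transition kernels), $c:\mathbb X\times\mathbb U\to\mathbb R$ a cost function and $\beta\in(0,1)$. An admissible policy $\gamma=\{\gamma_t\}_{t\ge 0}\in\Gamma$ is a sequence of measurable functions giving the actions $U_t=\gamma_t(Y_0,\dots,Y_t,U_0,\dots,U_{t-1})\in\mathbb U$. For a transition kernel $\mathcal S\in\{\mathcal T,\mathcal T_1,\mathcal T_2,\dots\}$ and $\gamma\in\Gamma$, the process $(X_t,Y_t,U_t)_{t\ge0}$ has $X_0\sim P$; given the past up to time $t-1$, $X_t\sim\mathcal S(\cdot\,|X_{t-1},U_{t-1})$ for $t\ge1$; given these and $X_t$, $Y_t\sim Q(\cdot\,|X_t)$; and $U_t$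 is chosen by $\gamma_t$. Put $$J_\beta(P,\mathcal S,\gamma)=E_P^{\mathcal S,\gamma}\Big[\sum_{t=0}^\infty\beta^t c(X_t,U_t)\Big],\qquad J_\beta^*(P,\mathcal S)=\inf_{\gamma\in\Gamma}J_\beta(P,\mathcal S,\gamma).$$ **Theorem.** Suppose that 1. $\mathcal T(\cdot\,|x,u)$ is weakly continuous in $(x,u)$; 2. $Q$ is continuous in total variation: if $x_k\to x$ in $\mathbb X$, then $\|Q(\cdot\,|x_k)-Q(\cdot\,|x)\|_{TV}\to0$, where $\|\mu-\nu\|_{TV}=2\sup_B|\mu(B)-\nu(B)|$ over Borel sets $B$; 3. $c$ is continuous and bounded on $\mathbb X\times\mathbb U$; 4. $\mathbb U$ is compact; 5. $\mathcal T_n(\cdot\,|x_n,u_n)\to\mathcal T(\cdot\,|x,u)$ weakly whenever $(x_n,u_n)\to(x,u)$ in $\mathbb X\times\mathbb U$. Then, as $n\to\infty$, $$\sup_{\gamma\in\Gamma}\big|J_\beta(P,\mathcal T_n,\gamma)-J_\beta(P,\mathcal T,\gamma)\big|\to0 \qquad\text{and}\qquad \big|J_\beta^*(P,\mathcal T_n)-J_\beta^*(P,\mathcal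 T)\big|\to0 .$$ -/

import Mathlib

open MeasureTheory ProbabilityTheory Filter Topology Set

/-- The total variation distance `‖μ - ν‖_TV = 2 sup_B |μ(B) - ν(B)|`, the supremum being over
all measurable sets `B`. -/
noncomputable def tvDist {E : Type*} [MeasurableSpace E] (μ ν : Measure E) : ℝ :=
  2 * ⨆ B : {B : Set E // MeasurableSet B}, |μ.real B - ν.real B|

/-- The value `κ(· | a)` of a stochastic kernel as a point of the space of probability measures,
which carries the topology of weak convergence. -/
def kernelLaw {A E : Type*} [MeasurableSpace A] [MeasurableSpace E]
    (κ : Kernel A E) [IsMarkovKernel κ] (a : A) : ProbabilityMeasure E :=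
  ⟨κ a, inferInstance⟩

/-- An admissible policy: at time `t` the action is a measurable function `γ_t` of the
information `I_t = (Y_0, …, Y_t, U_0, …, U_{t-1})`. -/
structure AdmissiblePolicy (Y U : Type*) [MeasurableSpace Y] [MeasurableSpace U] where
  act : (t : ℕ) → (Fin (t + 1) → Y) × (Fin t → U) → U
  measurable_act : ∀ t, Measurable (act t)

section ControlledProcess

variable {X Y U : Type*} [MeasurableSpace X] [MeasurableSpace Y] [MeasurableSpace U]

/-- Finite histories `((x_i, y_i), u_i)_{0 ≤ i ≤ t}` of states, observations and actions. -/
abbrev History (X Y U : Type*) (t : ℕ) : Type _ := Finset.Iic t → (X × Y) × U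

/-- The last state and action `(x_t, u_t)` of a history up to time `t`. -/
def lastStateAction (t : ℕ) (h : History X Y U t) : X × U :=
  ((h ⟨t, Finset.mem_Iic.2 le_rfl⟩).1.1, (h ⟨t, Finset.mem_Iic.2 le_rfl⟩).2)

theorem measurable_lastStateAction (t : ℕ) :
    Measurable (lastStateAction (X := X) (Y := Y) (U := U) t) := by
  unfold lastStateAction
  fun_prop

/-- The information `I_{t+1} = (y_0, …, y_t, y_{t+1}, u_0, …, u_t)` obtained from a history up to
time `t` together with a new state-observation pair `(x_{t+1}, y_{t+1})`. -/
def nextInfo (t : ℕ) (p : History X Y U t × (X × Y)) :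
    (Fin (t + 2) → Y) × (Fin (t + 1) → U) :=
  (Fin.snoc (α := fun _ => Y)
      (fun i : Fin (t + 1) => (p.1 ⟨i, Finset.mem_Iic.2 (Nat.lt_succ_iff.1 i.2)⟩).1.2) p.2.2,
    fun i : Fin (t + 1) => (p.1 ⟨i, Finset.mem_Iic.2 (Nat.lt_succ_iff.1 i.2)⟩).2)

theorem measurable_nextInfo (t : ℕ) : Measurable (nextInfo (X := X) (Y := Y) (U := U) t) := by
  unfold nextInfo
  refine Measurable.prodMk (measurable_pi_lambda _ fun i => ?_)
    (measurable_pi_lambda _ fun i => by fun_prop)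
  refine Fin.lastCases ?_ (fun j => ?_) i
  · simp only [Fin.snoc_last]; fun_prop
  · simp only [Fin.snoc_castSucc]; fun_prop

/-- One step of the controlled process: given the history up to time `t`,
`x_{t+1} ∼ T(· | x_t, u_t)`, then `y_{t+1} ∼ Q(· | x_{t+1})`, then `u_{t+1} = γ_{t+1}(I_{t+1})`. -/
noncomputable def stepKernel (T : Kernel (X × U) X) (Q : Kernel X Y) (γ : AdmissiblePolicy Y U)
    (t : ℕ) : Kernel (History X Y U t) ((X × Y) × U) :=
  (T.comap (lastStateAction t) (measurable_lastStateAction t) ⊗ₖ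
      Q.comap (fun p : History X Y U t × X => p.2) measurable_snd) ⊗ₖ
    Kernel.deterministic (fun p : History X Y U t × (X × Y) => γ.act (t + 1) (nextInfo t p))
      ((γ.measurable_act (t + 1)).comp (measurable_nextInfo t))

instance stepKernel.instIsMarkovKernel (T : Kernel (X × U) X) [IsMarkovKernel T]
    (Q : Kernel X Y) [IsMarkovKernel Q] (γ : AdmissiblePolicy Y U) (t : ℕ) :
    IsMarkovKernel (stepKernel T Q γ t) := by
  unfold stepKernel
  infer_instance

/-- The law of `((X_0, Y_0), U_0)`: `X_0 ∼ P`, `Y_0 ∼ Q(· | X_0)` and `U_0 = γ_0(Y_0)`. -/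
noncomputable def initialLaw (P : Measure X) (Q : Kernel X Y) (γ : AdmissiblePolicy Y U) :
    Measure ((X × Y) × U) :=
  (P ⊗ₘ Q).map fun p => (p, γ.act 0 (fun _ => p.2, Fin.elim0))

/-- The law of the controlled process `((X_t, Y_t), U_t)_{t ≥ 0}` with initial state distribution
`P`, transition kernel `T` and observation channel `Q` under the policy `γ`. -/
noncomputable def processLaw (P : Measure X) (T : Kernel (X × U) X) [IsMarkovKernel T]
    (Q : Kernel X Y) [IsMarkovKernel Q] (γ : AdmissiblePolicy Y U) :
    Measure (ℕ → (X × Y) × U) :=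
  Kernel.trajMeasure (X := fun _ => (X × Y) × U) (initialLaw P Q γ) (stepKernel T Q γ)

/-- The discounted cost `J_β(P, T, γ) = E[∑_{t ≥ 0} β^t c(X_t, U_t)]`. -/
noncomputable def discountedCost (β : ℝ) (c : X × U → ℝ) (Q : Kernel X Y) [IsMarkovKernel Q]
    (P : Measure X) (T : Kernel (X × U) X) [IsMarkovKernel T] (γ : AdmissiblePolicy Y U) : ℝ :=
  ∫ ω, ∑' t : ℕ, β ^ t * c ((ω t).1.1, (ω t).2) ∂(processLaw P T Q γ)

/-- The optimal discounted cost `J_β^*(P, T) = inf_γ J_β(P, T, γ)` over admissible policies. -/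
noncomputable def optimalCost (β : ℝ) (c : X × U → ℝ) (Q : Kernel X Y) [IsMarkovKernel Q]
    (P : Measure X) (T : Kernel (X × U) X) [IsMarkovKernel T] : ℝ :=
  ⨅ γ : AdmissiblePolicy Y U, discountedCost β c Q P T γ

end ControlledProcess

/-! The expected cost at a fixed time `k` is an iterated integral of `c` through transitions and the
observation channel. The backward recursion `costToGo` treats the policy and the past observations
and actions as an index `i`. The notion that survives the recursion is continuous convergence
uniform in this index: `F a i y → G i x` as `a` runs along its filter and `y → x`, uniformly in `i`.
No regularity of policies in the observations is then needed, since a new observation and action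
merely move the index.

One backward step has two halves. Averaging over `Q` (`TendstoUniformly.integral_channel`) keeps the
convergence because total variation continuity controls the change of channel for every bounded
measurable integrand, and compactness of the action space gives uniformity over the action chosen.
Averaging over the transition (`tendstoUniformly_integral_of_tendsto`) keeps it because locally
uniform control turns weak convergence into convergence of integrals uniform in the index: cut the
space into countably many cells with null boundary, on which all the functions are nearly constant,
and keep finitely many of them.

Induction (`tendstoUniformly_costToGo`) and the tower property (`integral_cost_eq`) give convergence
of each stage cost uniformly over policies. Discounting dominates the tail of the series, and an
infimum moves by at most the uniform distance. -/

/-! ### Continuous convergence uniform in an index, and integrals under weak convergence -/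

/-- A locally uniform limit of functions along `l ×ˢ 𝓝 x` is continuous, uniformly in the index. -/
theorem TendstoUniformly.nhds_of_prod_nhds {A I E : Type*} [TopologicalSpace E] {l : Filter A}
    [l.NeBot] {F : A → I → E → ℝ} {G : I → E → ℝ}
    (h : ∀ x, TendstoUniformly (fun (p : A × E) i => F p.1 i p.2) (fun i => G i x) (l ×ˢ 𝓝 x))
    (x : E) : TendstoUniformly (fun y i => G i y) (fun i => G i x) (𝓝 x) := by
  rw [Metric.tendstoUniformly_iff]
  intro ε hε
  obtain ⟨p, hp, q, hq, hpq⟩ := eventually_prod_iff.1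
    (Metric.tendstoUniformly_iff.1 (h x) (ε / 2) (half_pos hε))
  filter_upwards [hq] with y hy i
  -- Freezing the point at `y` gives convergence at `y` itself. The intermediate `a` may depend on
  -- `y`, but not on `i`.
  have hy' : ∀ᶠ a in l, ∀ i, dist (G i y) (F a i y) < ε / 2 :=
    (tendsto_id.prodMk (tendsto_const_nhds (x := y))).eventually
      (Metric.tendstoUniformly_iff.1 (h y) (ε / 2) (half_pos hε))
  obtain ⟨a, ha, ha'⟩ := (hp.and hy').exists
  calc dist (G i x) (G i y) ≤ dist (G i x) (F a i y) + dist (G i y) (F a i y) :=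
        dist_triangle_right _ _ _
    _ < ε / 2 + ε / 2 := add_lt_add (hpq ha hy i) (ha' i)
    _ = ε := add_halves ε

/-- Comparison of the integrals of two functions, which are both close to the constant `v` on `S`,
with respect to two measures. -/
theorem abs_setIntegral_sub_setIntegral_le {E : Type*} [MeasurableSpace E] {μ ν : Measure E}
    [IsProbabilityMeasure μ] [IsProbabilityMeasure ν] {S : Set E}
    {f g : E → ℝ} {v C δ : ℝ} (hf : Integrable f μ) (hg : Integrable g ν) (hv : |v| ≤ C)
    (hfv : ∀ x ∈ S, |f x - v| ≤ δ) (hgv : ∀ x ∈ S, |g x - v| ≤ δ) :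
    |∫ x in S, f x ∂μ - ∫ x in S, g x ∂ν| ≤
      δ * μ.real S + δ * ν.real S + C * |μ.real S - ν.real S| := by
  have key : ∀ (ρ : Measure E) [IsProbabilityMeasure ρ] (h : E → ℝ), Integrable h ρ →
      (∀ x ∈ S, |h x - v| ≤ δ) → |∫ x in S, h x ∂ρ - v * ρ.real S| ≤ δ * ρ.real S := by
    intro ρ _ h hh hhv
    have h1 : ∫ x in S, (h x - v) ∂ρ = ∫ x in S, h x ∂ρ - v * ρ.real S := by
      rw [integral_sub hh.integrableOn (integrable_const v)]
      simp [mul_comm]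
    rw [← h1]
    exact norm_setIntegral_le_of_norm_le_const (f := fun x => h x - v) (measure_lt_top _ _) hhv
  have h1 := abs_le.1 (key μ f hf hfv)
  have h2 := abs_le.1 (key ν g hg hgv)
  have h3 : |v * (μ.real S - ν.real S)| ≤ C * |μ.real S - ν.real S| := by
    rw [abs_mul]; gcongr
  have h3 := abs_le.1 h3
  rw [abs_le]
  constructor <;> linarith

/-- Each cell arises from some `B j` by removing finitely many others, and the frontier of a
difference lies in the union of the two frontiers. Portmanteau thus applies to the cells of the
partition as well as to the balls. -/
theorem null_frontier_disjointed {E : Type*} [TopologicalSpace E] [MeasurableSpace E]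
    {μ : Measure E} {B : ℕ → Set E} (hB : ∀ j, μ (frontier (B j)) = 0) (j : ℕ) :
    μ (frontier (disjointed B j)) = 0 := by
  refine disjointedRec (p := fun S => μ (frontier S) = 0) (fun t i ht => ?_) (hB j)
  refine measure_mono_null ?_ (measure_union_null ht (hB i))
  rw [sdiff_eq]
  refine (frontier_inter_subset _ _).trans (union_subset_union inter_subset_left ?_)
  rw [frontier_compl]
  exact inter_subset_right

/-- The integrals of uniformly bounded functions, which converge continuously and uniformly in the
index, with respect to weakly convergent probability measures converge uniformly in the index. -/
theorem tendstoUniformly_integral_of_tendsto {A I E : Type*} [PseudoMetricSpace E]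
    [SecondCountableTopology E] [MeasurableSpace E] [OpensMeasurableSpace E] {l : Filter A}
    [l.NeBot] {μs : A → ProbabilityMeasure E} {μ : ProbabilityMeasure E}
    (hμ : Tendsto μs l (𝓝 μ)) {F : A → I → E → ℝ} {G : I → E → ℝ} {C : ℝ} (hC : 0 ≤ C)
    (hFm : ∀ a i, Measurable (F a i)) (hGm : ∀ i, Measurable (G i))
    (hFC : ∀ a i x, |F a i x| ≤ C) (hGC : ∀ i x, |G i x| ≤ C)
    (h : ∀ x, TendstoUniformly (fun (p : A × E) i => F p.1 i p.2) (fun i => G i x) (l ×ˢ 𝓝 x)) :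
    TendstoUniformly (fun a i => ∫ x, F a i x ∂(μs a : Measure E))
      (fun i => ∫ x, G i x ∂(μ : Measure E)) l := by
  rw [Metric.tendstoUniformly_iff]
  intro ε hε
  -- Error budget: `C * δ` for each of the two discarded tails, and `2 * δ + C * δ` on the retained
  -- cells.
  obtain ⟨δ, hδ, hδε⟩ : ∃ δ > 0, (2 + 3 * C) * δ < ε := by
    refine ⟨ε / (3 + 3 * C), by positivity, ?_⟩
    rw [mul_div_assoc', div_lt_iff₀ (by positivity)]
    nlinarith
  have hball : ∀ x : E, ∃ r > 0, (μ : Measure E) (frontier (Metric.ball x r)) = 0 ∧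
      ∀ᶠ a in l, ∀ y ∈ Metric.ball x r, ∀ i, |F a i y - G i x| ≤ δ ∧ |G i y - G i x| ≤ δ := by
    intro x
    obtain ⟨p, hp, q, hq, hpq⟩ := eventually_prod_iff.1 (Metric.tendstoUniformly_iff.1 (h x) δ hδ)
    have hq' := Metric.tendstoUniformly_iff.1 (TendstoUniformly.nhds_of_prod_nhds h x) δ hδ
    obtain ⟨s, hs, hball⟩ := Metric.eventually_nhds_iff_ball.1 (hq.and hq')
    -- Distinct radii have disjoint sphere-like frontiers, so only countably many carry mass, and a
    -- good radius exists below `s`.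
    obtain ⟨r, hr, hr0⟩ := exists_null_frontier_thickening (μ : Measure E) {x} hs
    rw [Metric.thickening_singleton] at hr0
    refine ⟨r, hr.1, hr0, ?_⟩
    filter_upwards [hp] with a ha y hy i
    have hy' := hball y (Metric.ball_subset_ball hr.2.le hy)
    constructor
    · have := hpq ha hy'.1 i
      rw [dist_comm, Real.dist_eq] at this
      exact this.le
    · have := hy'.2 i
      rw [dist_comm, Real.dist_eq] at this
      exact this.le
  choose r hr hr0 hev using hball
  have : Nonempty E := nonempty_of_isProbabilityMeasure (μ : Measure E)
  obtain ⟨s, hs, hcov⟩ := TopologicalSpace.countable_cover_nhds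
    (fun x : E => Metric.ball_mem_nhds x (hr x))
  have hsne : s.Nonempty := by
    by_contra hne
    rw [not_nonempty_iff_eq_empty] at hne
    rw [hne, biUnion_empty] at hcov
    exact empty_ne_univ hcov
  obtain ⟨x, rfl⟩ := hs.exists_eq_range hsne
  rw [biUnion_range] at hcov
  set B : ℕ → Set E := fun j => Metric.ball (x j) (r (x j)) with hBdef
  set D : ℕ → Set E := disjointed B with hDdef
  have hBm : ∀ j, MeasurableSet (B j) := fun j => measurableSet_ball
  have hDm : ∀ j, MeasurableSet (D j) := fun j => MeasurableSet.disjointed hBm j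
  have hDd : Pairwise (Function.onFun Disjoint D) := disjoint_disjointed B
  have hDU : ⋃ j, D j = univ := by rw [hDdef, iUnion_disjointed]; exact hcov
  have hD0 : ∀ j, (μ : Measure E) (frontier (D j)) = 0 :=
    null_frontier_disjointed fun j => hr0 (x j)
  have hDB : ∀ j, D j ⊆ B j := disjointed_subset B
  have hsum : HasSum (fun j => (μ : Measure E).real (D j)) 1 := by
    have h1 := hasSum_integral_iUnion (μ := (μ : Measure E)) (f := fun _ => (1 : ℝ)) hDm hDd
      (integrable_const _).integrableOn
    simpa [hDU] using h1
  -- Finitely many cells carry `μ`-mass above `1 - δ`. By portmanteau the same cells eventually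
  -- carry as much mass under `μs a`, so both tails are small.
  obtain ⟨m, hm⟩ := ((hsum.tendsto_sum_nat).eventually (lt_mem_nhds (sub_lt_self 1 hδ))).exists
  have hμD : ∀ j, Tendsto (fun a => (μs a : Measure E).real (D j)) l
      (𝓝 ((μ : Measure E).real (D j))) := fun j =>
    (ENNReal.tendsto_toReal (measure_ne_top _ _)).comp
      (ProbabilityMeasure.tendsto_measure_of_null_frontier_of_tendsto' hμ (hD0 j))
  have hμabs : Tendsto (fun a => ∑ j ∈ Finset.range m,
      |(μs a : Measure E).real (D j) - (μ : Measure E).real (D j)|) l (𝓝 0) := by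
    rw [← Finset.sum_const_zero (s := Finset.range m)]
    refine tendsto_finsetSum _ fun j _ => ?_
    simpa using ((hμD j).sub_const ((μ : Measure E).real (D j))).abs
  have hsumlt := (tendsto_finsetSum (Finset.range m) fun j _ => hμD j).eventually (lt_mem_nhds hm)
  have hall : ∀ᶠ a in l, ∀ j ∈ Finset.range m, ∀ y ∈ B j, ∀ i,
      |F a i y - G i (x j)| ≤ δ ∧ |G i y - G i (x j)| ≤ δ :=
    (Finset.eventually_all _).2 fun j _ => hev (x j)
  filter_upwards [hμabs.eventually (gt_mem_nhds hδ), hsumlt, hall] with a ha1 ha2 ha3 i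
  have hint : ∀ (ρ : Measure E) [IsProbabilityMeasure ρ] (f : E → ℝ), Measurable f →
      (∀ x, |f x| ≤ C) → Integrable f ρ := fun ρ _ f hf hfC =>
    Integrable.of_bound hf.aestronglyMeasurable C (Eventually.of_forall hfC)
  have hFi := hint (μs a : Measure E) (F a i) (hFm a i) (hFC a i)
  have hGi := hint (μ : Measure E) (G i) (hGm i) (hGC i)
  have hdecomp : ∀ (ρ : Measure E) [IsProbabilityMeasure ρ] (f : E → ℝ), Integrable f ρ →
      (∀ x, |f x| ≤ C) → 1 - δ < ∑ j ∈ Finset.range m, ρ.real (D j) →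
      |∫ x, f x ∂ρ - ∑ j ∈ Finset.range m, ∫ x in D j, f x ∂ρ| ≤ C * δ := by
    intro ρ _ f hf hfC hlt
    have hU : MeasurableSet (⋃ j ∈ Finset.range m, D j) :=
      Finset.measurableSet_biUnion _ fun j _ => hDm j
    have hdisj : ((Finset.range m : Finset ℕ) : Set ℕ).Pairwise (Function.onFun Disjoint D) :=
      hDd.set_pairwise _
    rw [← integral_biUnion_finset _ (fun j _ => hDm j) hdisj (fun j _ => hf.integrableOn),
      ← integral_add_compl hU hf, add_sub_cancel_left]
    have hmeas : ρ.real (⋃ j ∈ Finset.range m, D j)ᶜ ≤ δ := by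
      rw [probReal_compl_eq_one_sub hU, measureReal_biUnion_finset hdisj (fun j _ => hDm j)]
      linarith
    exact (norm_setIntegral_le_of_norm_le_const (f := f) (measure_lt_top _ _) fun x _ => hfC x).trans
      (mul_le_mul_of_nonneg_left hmeas hC)
  have h1 := abs_le.1 (hdecomp (μs a) (F a i) hFi (hFC a i) ha2)
  have h2 := abs_le.1 (hdecomp μ (G i) hGi (hGC i) hm)
  have hle1 : ∀ (ρ : Measure E) [IsProbabilityMeasure ρ],
      ∑ j ∈ Finset.range m, ρ.real (D j) ≤ 1 := by
    intro ρ _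
    rw [← measureReal_biUnion_finset (hDd.set_pairwise _) (fun j _ => hDm j)]
    exact measureReal_le_one
  have h3 : |∑ j ∈ Finset.range m, ∫ x in D j, F a i x ∂(μs a : Measure E) -
      ∑ j ∈ Finset.range m, ∫ x in D j, G i x ∂(μ : Measure E)| ≤ 2 * δ + C * δ := by
    rw [← Finset.sum_sub_distrib]
    refine (Finset.abs_sum_le_sum_abs _ _).trans ?_
    refine (Finset.sum_le_sum fun j hj => abs_setIntegral_sub_setIntegral_le hFi hGi
      (hGC i (x j)) (fun y hy => (ha3 j hj y (hDB j hy) i).1)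
      (fun y hy => (ha3 j hj y (hDB j hy) i).2)).trans ?_
    rw [Finset.sum_add_distrib, Finset.sum_add_distrib, ← Finset.mul_sum, ← Finset.mul_sum,
      ← Finset.mul_sum]
    nlinarith [hle1 (μs a : Measure E), hle1 (μ : Measure E),
      mul_le_mul_of_nonneg_left ha1.le hC]
  have h3 := abs_le.1 h3
  rw [Real.dist_eq, abs_lt]
  constructor <;> linarith

/-! ### Total variation and integrals of bounded functions -/

theorem abs_integral_le_of_abs_le {E : Type*} [MeasurableSpace E] {μ : Measure E}
    [IsProbabilityMeasure μ] {f : E → ℝ} {C : ℝ} (h : ∀ x, |f x| ≤ C) : |∫ x, f x ∂μ| ≤ C :=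
  (norm_integral_le_of_norm_le_const (f := f) (Eventually.of_forall h)).trans_eq
    (by rw [probReal_univ, mul_one])

theorem abs_measureReal_sub_le_tvDist {E : Type*} [MeasurableSpace E] (μ ν : Measure E)
    [IsProbabilityMeasure μ] [IsProbabilityMeasure ν] {B : Set E} (hB : MeasurableSet B) :
    |μ.real B - ν.real B| ≤ tvDist μ ν / 2 := by
  rw [tvDist, mul_div_cancel_left₀ _ (two_ne_zero' ℝ)]
  refine le_ciSup (f := fun B : {B : Set E // MeasurableSet B} => |μ.real B - ν.real B|)
    ⟨1, ?_⟩ ⟨B, hB⟩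
  rintro _ ⟨S, rfl⟩
  have h1 : μ.real S ≤ 1 := measureReal_le_one
  have h2 : ν.real S ≤ 1 := measureReal_le_one
  have h3 : 0 ≤ μ.real S := measureReal_nonneg
  have h4 : 0 ≤ ν.real S := measureReal_nonneg
  exact abs_le.2 ⟨by linarith, by linarith⟩

/-- Integrals of a bounded function depend in a Lipschitz way on the measure for the total
variation distance. -/
theorem abs_integral_sub_le_tvDist {E : Type*} [MeasurableSpace E] (μ ν : Measure E)
    [IsProbabilityMeasure μ] [IsProbabilityMeasure ν] {f : E → ℝ} {C : ℝ} (hC : 0 ≤ C)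
    (hf : Measurable f) (hfC : ∀ x, |f x| ≤ C) :
    |∫ x, f x ∂μ - ∫ x, f x ∂ν| ≤ C * tvDist μ ν := by
  -- Layer-cake formula for `f + C`, which takes values in `[0, 2 * C]`. Superlevel sets differ in
  -- mass by at most `tvDist μ ν / 2`, so an interval of length `2 * C` yields exactly the constant
  -- `C`.
  have key : ∀ (ρ : Measure E) [IsProbabilityMeasure ρ],
      ∫ x, f x ∂ρ = (∫ t in Ioc 0 (2 * C), ρ.real {x | t ≤ f x + C}) - C ∧
        IntegrableOn (fun t => ρ.real {x | t ≤ f x + C}) (Ioc 0 (2 * C)) := by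
    intro ρ _
    have hfi : Integrable f ρ :=
      Integrable.of_bound hf.aestronglyMeasurable C (Eventually.of_forall hfC)
    constructor
    · have h1 := Integrable.integral_eq_integral_Ioc_meas_le (f := fun x => f x + C) (M := 2 * C)
        (hfi.add (integrable_const C))
        (Eventually.of_forall fun x => neg_le_iff_add_nonneg.1 (abs_le.1 (hfC x)).1)
        (Eventually.of_forall fun x => by linarith [(abs_le.1 (hfC x)).2])
      rw [← h1, integral_add hfi (integrable_const C)]
      simp
    · have hanti : Antitone fun t => ρ.real {x | t ≤ f x + C} := fun s t hst =>
        measureReal_mono fun x (hx : t ≤ f x + C) => hst.trans hx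
      exact IntegrableOn.of_bound measure_Ioc_lt_top hanti.measurable.aestronglyMeasurable 1
        (Eventually.of_forall fun t => by
          rw [Real.norm_of_nonneg measureReal_nonneg]; exact measureReal_le_one)
  rw [(key μ).1, (key ν).1, sub_sub_sub_cancel_right, ← integral_sub (key μ).2 (key ν).2]
  refine (norm_setIntegral_le_of_norm_le_const
    (f := fun t => μ.real {x | t ≤ f x + C} - ν.real {x | t ≤ f x + C}) (C := tvDist μ ν / 2)
    measure_Ioc_lt_top fun t _ =>
    abs_measureReal_sub_le_tvDist μ ν (measurableSet_le measurable_const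
      (hf.add_const C))).trans_eq ?_
  rw [Real.volume_real_Ioc_of_le (by positivity)]
  ring

/-! ### Uniformity in the action and averaging over the channel -/

/-- Over a compact second factor, continuous convergence is uniform in the second variable. -/
theorem TendstoUniformly.prod_compactSpace {A I X U : Type*} [TopologicalSpace X]
    [TopologicalSpace U] [CompactSpace U] {l : Filter A} [l.NeBot] {H : A → I → X × U → ℝ}
    {H₀ : I → X × U → ℝ}
    (h : ∀ z, TendstoUniformly (fun (p : A × (X × U)) i => H p.1 i p.2) (fun i => H₀ i z)
      (l ×ˢ 𝓝 z)) (x : X) :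
    TendstoUniformly (fun (p : A × X) (q : I × U) => H p.1 q.1 (p.2, q.2))
      (fun q => H₀ q.1 (x, q.2)) (l ×ˢ 𝓝 x) := by
  rw [Metric.tendstoUniformly_iff]
  intro ε hε
  have key : ∀ u : U, ∀ᶠ w in (l ×ˢ 𝓝 x) ×ˢ 𝓝 u,
      ∀ i, dist (H₀ i (x, w.2)) (H w.1.1 i (w.1.2, w.2)) < ε := by
    intro u
    have t1 : Tendsto (fun w : (A × X) × U => (w.1.1, (w.1.2, w.2))) ((l ×ˢ 𝓝 x) ×ˢ 𝓝 u)
        (l ×ˢ 𝓝 (x, u)) := by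
      rw [nhds_prod_eq]
      exact (tendsto_fst.comp tendsto_fst).prodMk
        ((tendsto_snd.comp tendsto_fst).prodMk tendsto_snd)
    have t2 : Tendsto (fun w : (A × X) × U => (x, w.2)) ((l ×ˢ 𝓝 x) ×ˢ 𝓝 u) (𝓝 (x, u)) := by
      rw [nhds_prod_eq]
      exact tendsto_const_nhds.prodMk tendsto_snd
    -- The target `H₀ i (x, w.2)` also moves with the action, so continuity of the limit, uniform in
    -- `i`, is needed besides the convergence of `H`.
    filter_upwards [t1.eventually (Metric.tendstoUniformly_iff.1 (h (x, u)) _ (half_pos hε)),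
      t2.eventually (Metric.tendstoUniformly_iff.1
        (TendstoUniformly.nhds_of_prod_nhds h (x, u)) _ (half_pos hε))] with w h1 h2 i
    calc _ ≤ dist (H₀ i (x, u)) (H₀ i (x, w.2)) + dist (H₀ i (x, u)) (H w.1.1 i (w.1.2, w.2)) :=
          dist_triangle_left _ _ _
      _ < ε / 2 + ε / 2 := add_lt_add (h2 i) (h1 i)
      _ = ε := add_halves ε
  -- Tube lemma: the local statements around each `u` combine into one neighbourhood valid for all
  -- actions.
  have hmem := isCompact_univ.mem_prod_nhdsSet_of_forall (l := l ×ˢ 𝓝 x) fun u _ => key u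
  rw [nhdsSet_univ, mem_prod_top] at hmem
  filter_upwards [hmem] with p hp q
  exact hp q.2 q.1

/-- Continuous convergence is preserved by averaging over an observation channel which is continuous
in total variation, uniformly in the way in which the observation is used. -/
theorem TendstoUniformly.integral_channel {A I J X Y U : Type*} [TopologicalSpace X]
    [TopologicalSpace U] [CompactSpace U] [MeasurableSpace X] [MeasurableSpace Y]
    {l : Filter A} [l.NeBot] {Q : Kernel X Y} [IsMarkovKernel Q]
    (hQ : ∀ x, Tendsto (fun x' => tvDist (Q x') (Q x)) (𝓝 x) (𝓝 0))
    {H : A → I → X × U → ℝ} {H₀ : I → X × U → ℝ} {τ : J → Y → I} {α : J → Y → U} {C : ℝ}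
    (hC : 0 ≤ C) (hHm : ∀ a j x, Measurable fun y => H a (τ j y) (x, α j y))
    (hHm₀ : ∀ j x, Measurable fun y => H₀ (τ j y) (x, α j y))
    (hHC : ∀ a i z, |H a i z| ≤ C) (hHC₀ : ∀ i z, |H₀ i z| ≤ C)
    (h : ∀ z, TendstoUniformly (fun (p : A × (X × U)) i => H p.1 i p.2) (fun i => H₀ i z)
      (l ×ˢ 𝓝 z)) (x : X) :
    TendstoUniformly (fun (p : A × X) j => ∫ y, H p.1 (τ j y) (p.2, α j y) ∂Q p.2)
      (fun j => ∫ y, H₀ (τ j y) (x, α j y) ∂Q x) (l ×ˢ 𝓝 x) := by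
  rw [Metric.tendstoUniformly_iff]
  intro ε hε
  have htv : ∀ᶠ p : A × X in l ×ˢ 𝓝 x, C * tvDist (Q p.2) (Q x) < ε / 2 := by
    have := ((hQ x).comp (tendsto_snd (f := l))).const_mul C
    rw [mul_zero] at this
    exact this.eventually (gt_mem_nhds (half_pos hε))
  filter_upwards [htv, Metric.tendstoUniformly_iff.1 (TendstoUniformly.prod_compactSpace h x) _
    (half_pos hε)] with p h1 h2 j
  have hi : Integrable (fun y => H p.1 (τ j y) (p.2, α j y)) (Q x) :=
    Integrable.of_bound (hHm _ _ _).aestronglyMeasurable C (Eventually.of_forall fun y => hHC _ _ _)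
  have hi₀ : Integrable (fun y => H₀ (τ j y) (x, α j y)) (Q x) :=
    Integrable.of_bound (hHm₀ _ _).aestronglyMeasurable C (Eventually.of_forall fun y => hHC₀ _ _)
  -- The integrand is held fixed while the measure passes from `Q p.2` to `Q x`; `h4` then compares
  -- the integrands under `Q x` alone.
  have h3 := abs_integral_sub_le_tvDist (Q p.2) (Q x) hC (hHm p.1 j p.2) fun y => hHC _ _ _
  have h4 : |∫ y, H p.1 (τ j y) (p.2, α j y) ∂Q x - ∫ y, H₀ (τ j y) (x, α j y) ∂Q x| ≤ ε / 2 := by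
    rw [← integral_sub hi hi₀]
    refine abs_integral_le_of_abs_le fun y => ?_
    have := h2 (τ j y, α j y)
    rw [dist_comm, Real.dist_eq] at this
    exact this.le
  rw [dist_comm, Real.dist_eq]
  calc _ ≤ _ := abs_sub_le _ (∫ y, H p.1 (τ j y) (p.2, α j y) ∂Q x) _
    _ < ε / 2 + ε / 2 := add_lt_add_of_lt_of_le (h3.trans_lt h1) h4
    _ = ε := add_halves ε

/-! ### Backward recursion for the expected cost -/

section CostToGo

variable {X Y U : Type*} [MeasurableSpace X] [MeasurableSpace Y] [MeasurableSpace U]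

/-- The observations and actions `(y_0, …, y_t, u_0, …, u_t)` up to and including time `t`. -/
abbrev PastInfo (Y U : Type*) (t : ℕ) : Type _ := (Fin (t + 1) → Y) × (Fin (t + 1) → U)

/-- The action at time `t + 1` as a function of the past information and of the observation. -/
def AdmissiblePolicy.nextAction (γ : AdmissiblePolicy Y U) {t : ℕ} (ι : PastInfo Y U t) (y : Y) :
    U :=
  γ.act (t + 1) (Fin.snoc (α := fun _ => Y) ι.1 y, ι.2)

/-- The past information extended by a new observation and action. -/
def PastInfo.snoc {t : ℕ} (ι : PastInfo Y U t) (y : Y) (u : U) : PastInfo Y U (t + 1) :=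
  (Fin.snoc (α := fun _ => Y) ι.1 y, Fin.snoc (α := fun _ => U) ι.2 u)

/-- The expected cost after `k` further steps, given the information `ι` available to the
controller at time `t` and the current state and action `z`. -/
noncomputable def costToGo (c : X × U → ℝ) (S : Kernel (X × U) X) (Q : Kernel X Y)
    (γ : AdmissiblePolicy Y U) : ℕ → (t : ℕ) → PastInfo Y U t → X × U → ℝ
  | 0, _, _, z => c z
  | k + 1, t, ι, z => ∫ x, ∫ y, costToGo c S Q γ k (t + 1) (ι.snoc y (γ.nextAction ι y))
      (x, γ.nextAction ι y) ∂Q x ∂S z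

theorem measurable_finSnoc {E : Type*} [MeasurableSpace E] (t : ℕ) :
    Measurable fun p : (Fin t → E) × E => (Fin.snoc (α := fun _ => E) p.1 p.2 : Fin (t + 1) → E) := by
  refine measurable_pi_lambda _ fun i => ?_
  refine Fin.lastCases ?_ (fun j => ?_) i
  · simp only [Fin.snoc_last]; fun_prop
  · simp only [Fin.snoc_castSucc]; fun_prop

theorem PastInfo.measurable_snoc (t : ℕ) :
    Measurable fun p : PastInfo Y U t × (Y × U) => p.1.snoc p.2.1 p.2.2 :=
  ((measurable_finSnoc (t + 1)).comp
    ((measurable_fst.comp measurable_fst).prodMk (measurable_fst.comp measurable_snd))).prodMk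
    ((measurable_finSnoc (t + 1)).comp
      ((measurable_snd.comp measurable_fst).prodMk (measurable_snd.comp measurable_snd)))

theorem AdmissiblePolicy.measurable_nextAction (γ : AdmissiblePolicy Y U) (t : ℕ) :
    Measurable fun p : PastInfo Y U t × Y => γ.nextAction p.1 p.2 :=
  (γ.measurable_act (t + 1)).comp
    (((measurable_finSnoc (t + 1)).comp
      ((measurable_fst.comp measurable_fst).prodMk measurable_snd)).prodMk
      (measurable_snd.comp measurable_fst))

theorem measurable_next (γ : AdmissiblePolicy Y U) (t : ℕ) :
    Measurable fun p : (PastInfo Y U t × X) × Y =>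
      (p.1.1.snoc p.2 (γ.nextAction p.1.1 p.2), (p.1.2, γ.nextAction p.1.1 p.2)) := by
  have h1 : Measurable fun p : (PastInfo Y U t × X) × Y => γ.nextAction p.1.1 p.2 :=
    (γ.measurable_nextAction t).comp
      ((measurable_fst.comp measurable_fst).prodMk measurable_snd)
  exact ((PastInfo.measurable_snoc t).comp
    ((measurable_fst.comp measurable_fst).prodMk (measurable_snd.prodMk h1))).prodMk
    ((measurable_snd.comp measurable_fst).prodMk h1)

variable {c : X × U → ℝ} {S : Kernel (X × U) X} [IsMarkovKernel S] {Q : Kernel X Y}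
  [IsMarkovKernel Q]

theorem measurable_costToGo (hc : Measurable c) (γ : AdmissiblePolicy Y U) (k t : ℕ) :
    Measurable fun p : PastInfo Y U t × (X × U) => costToGo c S Q γ k t p.1 p.2 := by
  induction k generalizing t with
  | zero => exact hc.comp measurable_snd
  | succ k ih =>
    have h1 := ((ih (t + 1)).comp (measurable_next γ t)).stronglyMeasurable
    have h2 := h1.integral_kernel_prod_right' (κ := Q.comap Prod.snd measurable_snd)
    have h3 := (h2.comp_measurable (g := fun p : (PastInfo Y U t × (X × U)) × X => (p.1.1, p.2))
      (by fun_prop)).integral_kernel_prod_right' (κ := S.comap Prod.snd measurable_snd)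
    exact h3.measurable

theorem abs_costToGo_le {C : ℝ} (hcC : ∀ z, |c z| ≤ C) (γ : AdmissiblePolicy Y U) (k t : ℕ)
    (ι : PastInfo Y U t) (z : X × U) : |costToGo c S Q γ k t ι z| ≤ C := by
  induction k generalizing t z with
  | zero => exact hcC z
  | succ k ih =>
    exact abs_integral_le_of_abs_le fun x => abs_integral_le_of_abs_le fun y => ih _ _ _

theorem measurable_integral_costToGo (hc : Measurable c) (γ : AdmissiblePolicy Y U) (k t : ℕ) :
    Measurable fun p : PastInfo Y U t × X => ∫ y, costToGo c S Q γ k (t + 1)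
      (p.1.snoc y (γ.nextAction p.1 y)) (p.2, γ.nextAction p.1 y) ∂Q p.2 :=
  (((measurable_costToGo hc γ k (t + 1)).comp
    (measurable_next γ t)).stronglyMeasurable.integral_kernel_prod_right'
      (κ := Q.comap Prod.snd measurable_snd)).measurable

end CostToGo

/-! ### Continuous convergence of the costs to go -/

section Convergence

variable {X Y U : Type*} [PseudoMetricSpace X] [SecondCountableTopology X] [MeasurableSpace X]
  [OpensMeasurableSpace X] [MeasurableSpace Y] [TopologicalSpace U] [CompactSpace U]
  [MeasurableSpace U]

/-- Continuous convergence of the transition kernels implies continuous convergence of the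
expected costs to go, uniformly over all policies and past information. -/
theorem tendstoUniformly_costToGo {c : X × U → ℝ} {C : ℝ} (hC : 0 ≤ C) (hc : Continuous c)
    (hcm : Measurable c) (hcC : ∀ z, |c z| ≤ C) {Q : Kernel X Y} [IsMarkovKernel Q]
    (hQ : ∀ x, Tendsto (fun x' => tvDist (Q x') (Q x)) (𝓝 x) (𝓝 0))
    {T : Kernel (X × U) X} [IsMarkovKernel T] {Tn : ℕ → Kernel (X × U) X}
    [∀ n, IsMarkovKernel (Tn n)]
    (hT : ∀ z, Tendsto (fun p : ℕ × (X × U) => kernelLaw (Tn p.1) p.2) (atTop ×ˢ 𝓝 z)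
      (𝓝 (kernelLaw T z))) (k t : ℕ) (z : X × U) :
    TendstoUniformly
      (fun (p : ℕ × (X × U)) (i : AdmissiblePolicy Y U × PastInfo Y U t) =>
        costToGo c (Tn p.1) Q i.1 k t i.2 p.2)
      (fun i => costToGo c T Q i.1 k t i.2 z) (atTop ×ˢ 𝓝 z) := by
  induction k generalizing t z with
  | zero =>
    rw [Metric.tendstoUniformly_iff]
    intro ε hε
    filter_upwards [(hc.continuousAt.tendsto.comp (tendsto_snd (f := (atTop : Filter ℕ)))).eventually
      (Metric.ball_mem_nhds (c z) hε)] with p hp i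
    rw [dist_comm]
    exact hp
  | succ k ih =>
    -- The observation `y` shifts the index to the extended past `τ j y`, which is harmless because
    -- the induction hypothesis is uniform over all pasts.
    have h1 := TendstoUniformly.integral_channel hQ
      (H := fun n (i : AdmissiblePolicy Y U × PastInfo Y U (t + 1)) z =>
        costToGo c (Tn n) Q i.1 k (t + 1) i.2 z)
      (H₀ := fun i z => costToGo c T Q i.1 k (t + 1) i.2 z)
      (τ := fun (j : AdmissiblePolicy Y U × PastInfo Y U t) y =>
        (j.1, j.2.snoc y (j.1.nextAction j.2 y)))
      (α := fun j y => j.1.nextAction j.2 y) hC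
      (fun n j x => (measurable_costToGo hcm j.1 k (t + 1)).comp
        ((measurable_next j.1 t).comp (measurable_prodMk_left (x := (j.2, x)))))
      (fun j x => (measurable_costToGo hcm j.1 k (t + 1)).comp
        ((measurable_next j.1 t).comp (measurable_prodMk_left (x := (j.2, x)))))
      (fun n i z => abs_costToGo_le hcC i.1 k (t + 1) i.2 z)
      (fun i z => abs_costToGo_le hcC i.1 k (t + 1) i.2 z) (ih (t + 1))
    refine tendstoUniformly_integral_of_tendsto (hT z) hC
      (F := fun (p : ℕ × (X × U)) (j : AdmissiblePolicy Y U × PastInfo Y U t) x =>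
        ∫ y, costToGo c (Tn p.1) Q j.1 k (t + 1) (j.2.snoc y (j.1.nextAction j.2 y))
          (x, j.1.nextAction j.2 y) ∂Q x)
      (G := fun j x => ∫ y, costToGo c T Q j.1 k (t + 1) (j.2.snoc y (j.1.nextAction j.2 y))
          (x, j.1.nextAction j.2 y) ∂Q x)
      (fun p j => (measurable_integral_costToGo hcm j.1 k t).comp measurable_prodMk_left)
      (fun j => (measurable_integral_costToGo hcm j.1 k t).comp measurable_prodMk_left)
      (fun p j x => abs_integral_le_of_abs_le fun y => abs_costToGo_le hcC _ _ _ _ _)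
      (fun j x => abs_integral_le_of_abs_le fun y => abs_costToGo_le hcC _ _ _ _ _)
      fun x => ?_
    -- The integrand depends on `(n, z')` only through `n`; the moving point `z'` enters through the
    -- measure.
    have t1 : Tendsto (fun q : (ℕ × (X × U)) × X => (q.1.1, q.2)) ((atTop ×ˢ 𝓝 z) ×ˢ 𝓝 x)
        (atTop ×ˢ 𝓝 x) := (tendsto_fst.comp tendsto_fst).prodMk tendsto_snd
    exact fun u hu => t1.eventually (h1 x u hu)

end Convergence

/-! ### Identification of the recursion with expectations under the process law -/

section ProcessLaw

variable {X Y U : Type*} [MeasurableSpace X] [MeasurableSpace Y] [MeasurableSpace U]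

/-- The observations and actions recorded in a history. -/
def History.pastInfo {t : ℕ} (h : History X Y U t) : PastInfo Y U t :=
  (fun i => (h ⟨i, Finset.mem_Iic.2 (Nat.lt_succ_iff.1 i.2)⟩).1.2,
    fun i => (h ⟨i, Finset.mem_Iic.2 (Nat.lt_succ_iff.1 i.2)⟩).2)

theorem History.measurable_pastInfo (t : ℕ) :
    Measurable (History.pastInfo (X := X) (Y := Y) (U := U) (t := t)) := by
  unfold History.pastInfo
  fun_prop

instance initialLaw.instIsProbabilityMeasure (P : Measure X) [IsProbabilityMeasure P]
    (Q : Kernel X Y) [IsMarkovKernel Q] (γ : AdmissiblePolicy Y U) :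
    IsProbabilityMeasure (initialLaw P Q γ) := by
  refine Measure.isProbabilityMeasure_map (Measurable.aemeasurable ?_)
  have := γ.measurable_act 0
  fun_prop

instance processLaw.instIsProbabilityMeasure (P : Measure X) [IsProbabilityMeasure P]
    (S : Kernel (X × U) X) [IsMarkovKernel S] (Q : Kernel X Y) [IsMarkovKernel Q]
    (γ : AdmissiblePolicy Y U) : IsProbabilityMeasure (processLaw P S Q γ) := by
  unfold processLaw
  infer_instance

theorem processLaw_map_zero (P : Measure X) [IsProbabilityMeasure P]
    (S : Kernel (X × U) X) [IsMarkovKernel S] (Q : Kernel X Y) [IsMarkovKernel Q]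
    (γ : AdmissiblePolicy Y U) :
    (processLaw P S Q γ).map (fun ω => ω 0) = initialLaw P Q γ := by
  have h1 : (processLaw P S Q γ).map (Preorder.frestrictLe 0) =
      (initialLaw P Q γ).map
        (MeasurableEquiv.piUnique (fun _ : Finset.Iic 0 => (X × Y) × U)).symm := by
    rw [processLaw, Kernel.trajMeasure, Measure.map_comp _ _ (by fun_prop),
      Kernel.traj_map_frestrictLe, Kernel.partialTraj_self, Measure.id_comp]
  have h2 : (fun ω : ℕ → (X × Y) × U => ω 0) =
      (fun h : History X Y U 0 => h ⟨0, Finset.mem_Iic.2 le_rfl⟩) ∘ Preorder.frestrictLe 0 := rfl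
  rw [h2, ← Measure.map_map (by fun_prop) (by fun_prop), h1,
    Measure.map_map (by fun_prop) (by fun_prop)]
  exact Measure.map_id

variable {c : X × U → ℝ} {S : Kernel (X × U) X} [IsMarkovKernel S] {Q : Kernel X Y}
  [IsMarkovKernel Q] {P : Measure X} [IsProbabilityMeasure P]

/-- The cost to go with one more step, as an integral over the transition of the process. -/
theorem integral_stepKernel_costToGo (hc : Measurable c) {C : ℝ} (hcC : ∀ z, |c z| ≤ C)
    (γ : AdmissiblePolicy Y U) (k t : ℕ) (h : History X Y U t) :
    ∫ w, costToGo c S Q γ k (t + 1) (h.pastInfo.snoc w.1.2 w.2) (w.1.1, w.2)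
        ∂(stepKernel S Q γ t h) =
      costToGo c S Q γ (k + 1) t h.pastInfo (lastStateAction t h) := by
  have hm : Measurable fun w : (X × Y) × U =>
      costToGo c S Q γ k (t + 1) (h.pastInfo.snoc w.1.2 w.2) (w.1.1, w.2) :=
    (measurable_costToGo hc γ k (t + 1)).comp
      (((PastInfo.measurable_snoc t).comp
        (measurable_const.prodMk ((measurable_snd.comp measurable_fst).prodMk measurable_snd))).prodMk
        ((measurable_fst.comp measurable_fst).prodMk measurable_snd))
  have hi : ∀ (ρ : Measure ((X × Y) × U)) [IsProbabilityMeasure ρ], Integrable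
      (fun w => costToGo c S Q γ k (t + 1) (h.pastInfo.snoc w.1.2 w.2) (w.1.1, w.2)) ρ :=
    fun ρ _ => Integrable.of_bound hm.aestronglyMeasurable C
      (Eventually.of_forall fun w => abs_costToGo_le hcC _ _ _ _ _)
  have hm' : Measurable fun p : X × Y => costToGo c S Q γ k (t + 1)
      (h.pastInfo.snoc p.2 (γ.nextAction h.pastInfo p.2)) (p.1, γ.nextAction h.pastInfo p.2) :=
    hm.comp (measurable_id.prodMk ((γ.measurable_nextAction t).comp
      (measurable_const.prodMk measurable_snd)))
  have hi' : ∀ (ρ : Measure (X × Y)) [IsProbabilityMeasure ρ], Integrable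
      (fun p => costToGo c S Q γ k (t + 1) (h.pastInfo.snoc p.2 (γ.nextAction h.pastInfo p.2))
        (p.1, γ.nextAction h.pastInfo p.2)) ρ :=
    fun ρ _ => Integrable.of_bound hm'.aestronglyMeasurable C
      (Eventually.of_forall fun w => abs_costToGo_le hcC _ _ _ _ _)
  rw [stepKernel, ProbabilityTheory.integral_compProd (by rw [← stepKernel]; exact hi _)]
  -- Integrating out the deterministic layer substitutes the action for `w.2`. By unfolding, `γ.act
  -- (t + 1) (nextInfo t (h, p))` is `γ.nextAction h.pastInfo p.2`.
  refine (integral_congr_ae (Eventually.of_forall fun p =>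
    Kernel.integral_deterministic' _ (hm.comp measurable_prodMk_left).stronglyMeasurable)).trans ?_
  exact ProbabilityTheory.integral_compProd (hi' _)

/-- Tower property: conditioning on the history up to time `t`, the next triple has law `stepKernel
S Q γ t`, and one unfolding of the recursion is the integral against that kernel. -/
theorem integral_costToGo_succ (hc : Measurable c) {C : ℝ} (hcC : ∀ z, |c z| ≤ C)
    (γ : AdmissiblePolicy Y U) (k t : ℕ) :
    ∫ ω, costToGo c S Q γ (k + 1) t (History.pastInfo (Preorder.frestrictLe t ω))
        ((ω t).1.1, (ω t).2) ∂(processLaw P S Q γ) =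
      ∫ ω, costToGo c S Q γ k (t + 1) (History.pastInfo (Preorder.frestrictLe (t + 1) ω))
        ((ω (t + 1)).1.1, (ω (t + 1)).2) ∂(processLaw P S Q γ) := by
  set μ := processLaw P S Q γ with hμ
  let g : History X Y U t × ((X × Y) × U) → ℝ := fun q =>
    costToGo c S Q γ k (t + 1) (q.1.pastInfo.snoc q.2.1.2 q.2.2) (q.2.1.1, q.2.2)
  have hg : Measurable g := (measurable_costToGo hc γ k (t + 1)).comp
      (((PastInfo.measurable_snoc t).comp
        (((History.measurable_pastInfo t).comp measurable_fst).prodMk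
          ((measurable_snd.comp (measurable_fst.comp measurable_snd)).prodMk
            (measurable_snd.comp measurable_snd)))).prodMk
        ((measurable_fst.comp (measurable_fst.comp measurable_snd)).prodMk
          (measurable_snd.comp measurable_snd)))
  have hg' : Measurable fun h : History X Y U t =>
      costToGo c S Q γ (k + 1) t h.pastInfo (lastStateAction t h) :=
    (measurable_costToGo hc γ (k + 1) t).comp
      ((History.measurable_pastInfo t).prodMk (measurable_lastStateAction t))
  have : IsProbabilityMeasure (μ.map (Preorder.frestrictLe (π := fun _ => (X × Y) × U) t)) :=
    Measure.isProbabilityMeasure_map (by fun_prop)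
  have h1 : ∫ ω, costToGo c S Q γ (k + 1) t (History.pastInfo (Preorder.frestrictLe t ω))
        ((ω t).1.1, (ω t).2) ∂μ =
      ∫ h, costToGo c S Q γ (k + 1) t (History.pastInfo h) (lastStateAction t h)
        ∂(μ.map (Preorder.frestrictLe (π := fun _ => (X × Y) × U) t)) :=
    (integral_map (by fun_prop) hg'.aestronglyMeasurable).symm
  have h2 : (μ.map (Preorder.frestrictLe (π := fun _ => (X × Y) × U) t)) ⊗ₘ stepKernel S Q γ t =
      μ.map fun ω => (Preorder.frestrictLe t ω, ω (t + 1)) :=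
    Kernel.map_frestrictLe_trajMeasure_compProd_eq_map_trajMeasure
  rw [h1]
  simp_rw [← integral_stepKernel_costToGo hc hcC γ k t]
  rw [← Measure.integral_compProd (f := g) (Integrable.of_bound hg.aestronglyMeasurable C
      (Eventually.of_forall fun w => abs_costToGo_le hcC _ _ _ _ _)), h2,
    integral_map (by fun_prop) hg.aestronglyMeasurable]
  refine integral_congr_ae (Eventually.of_forall fun ω => ?_)
  simp only [g]
  congr 1
  -- The past information of the longer history is that of the shorter one with the new observation
  -- and action appended.
  refine Prod.ext (funext fun i => ?_) (funext fun i => ?_)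
  · refine Fin.lastCases ?_ (fun j => ?_) i <;> simp [PastInfo.snoc, History.pastInfo]
  · refine Fin.lastCases ?_ (fun j => ?_) i <;> simp [PastInfo.snoc, History.pastInfo]

theorem integral_costToGo_eq (hc : Measurable c) {C : ℝ} (hcC : ∀ z, |c z| ≤ C)
    (γ : AdmissiblePolicy Y U) (k t : ℕ) :
    ∫ ω, costToGo c S Q γ k t (History.pastInfo (Preorder.frestrictLe t ω))
        ((ω t).1.1, (ω t).2) ∂(processLaw P S Q γ) =
      ∫ ω, c ((ω (t + k)).1.1, (ω (t + k)).2) ∂(processLaw P S Q γ) := by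
  induction k generalizing t with
  | zero => rfl
  | succ k ih => rw [integral_costToGo_succ hc hcC, ih, add_right_comm, add_assoc]

/-- The expected cost at time `k` as an integral over the initial state and observation. -/
theorem integral_cost_eq (hc : Measurable c) {C : ℝ} (hcC : ∀ z, |c z| ≤ C)
    (γ : AdmissiblePolicy Y U) (k : ℕ) :
    ∫ ω, c ((ω k).1.1, (ω k).2) ∂(processLaw P S Q γ) =
      ∫ x, ∫ y, costToGo c S Q γ k 0 (fun _ => y, fun _ => γ.act 0 (fun _ => y, Fin.elim0))
        (x, γ.act 0 (fun _ => y, Fin.elim0)) ∂Q x ∂P := by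
  have hact := γ.measurable_act 0
  have hm : Measurable fun w : (X × Y) × U =>
      costToGo c S Q γ k 0 (fun _ => w.1.2, fun _ => w.2) (w.1.1, w.2) :=
    (measurable_costToGo hc γ k 0).comp
      (f := fun w : (X × Y) × U =>
        (((fun _ => w.1.2, fun _ => w.2), (w.1.1, w.2)) : PastInfo Y U 0 × (X × U))) (by fun_prop)
  have h1 := integral_costToGo_eq (S := S) (Q := Q) (P := P) hc hcC γ k 0
  rw [zero_add] at h1
  have h2 : ∫ w, costToGo c S Q γ k 0 (fun _ => w.1.2, fun _ => w.2) (w.1.1, w.2)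
      ∂(initialLaw P Q γ) = ∫ ω, costToGo c S Q γ k 0
        (History.pastInfo (Preorder.frestrictLe 0 ω)) ((ω 0).1.1, (ω 0).2)
        ∂(processLaw P S Q γ) := by
    rw [← processLaw_map_zero P S Q γ, integral_map (measurable_pi_apply 0).aemeasurable hm.aestronglyMeasurable]
    refine integral_congr_ae (Eventually.of_forall fun ω => ?_)
    simp only
    congr 1
    refine Prod.ext (funext fun i => ?_) (funext fun i => ?_) <;>
    · obtain rfl : i = 0 := Fin.fin_one_eq_zero i
      rfl
  have hp : Measurable fun p : X × Y => (p, γ.act 0 (fun _ => p.2, Fin.elim0)) := by fun_prop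
  rw [← h1, ← h2, initialLaw, integral_map hp.aemeasurable hm.aestronglyMeasurable]
  exact Measure.integral_compProd (Integrable.of_bound (hm.comp hp).aestronglyMeasurable C
    (Eventually.of_forall fun w => abs_costToGo_le hcC _ _ _ _ _))

end ProcessLaw

/-! ### From sequences to filters -/

/-- Convergence along all sequences `(n, z_n)` with `z_n → z` is convergence along
`atTop ×ˢ 𝓝 z`. -/
theorem tendsto_atTop_prod_nhds_of_seq {Z W : Type*} [TopologicalSpace Z]
    [FirstCountableTopology Z] [TopologicalSpace W] {K : ℕ → Z → W} {z : Z} {w : W}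
    (h : ∀ ζ : ℕ → Z, Tendsto ζ atTop (𝓝 z) → Tendsto (fun n => K n (ζ n)) atTop (𝓝 w)) :
    Tendsto (fun p : ℕ × Z => K p.1 p.2) (atTop ×ˢ 𝓝 z) (𝓝 w) := by
  refine tendsto_of_seq_tendsto fun u hu => tendsto_of_subseq_tendsto fun ns hns => ?_
  have hu1 : Tendsto (fun j => (u (ns j)).1) atTop atTop :=
    (tendsto_fst.comp hu).comp hns
  have hu2 : Tendsto (fun j => (u (ns j)).2) atTop (𝓝 z) :=
    (tendsto_snd.comp hu).comp hns
  obtain ⟨φ, hφ, hm⟩ := strictMono_subseq_of_tendsto_atTop hu1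
  refine ⟨φ, ?_⟩
  set m : ℕ → ℕ := fun j => (u (ns (φ j))).1 with hmdef
  -- Along a subsequence the indices `m j` increase strictly, so the points can be placed at those
  -- indices of a full sequence. Filling the gaps with `z` keeps the limit and makes the hypothesis
  -- applicable.
  set ζ : ℕ → Z := Function.extend m (fun j => (u (ns (φ j))).2) fun _ => z with hζdef
  have hm : StrictMono m := hm
  have hζm : ∀ j, ζ (m j) = (u (ns (φ j))).2 := fun j => hm.injective.extend_apply _ _ j
  have hζ : Tendsto ζ atTop (𝓝 z) := by
    intro V hV
    obtain ⟨J, hJ⟩ := eventually_atTop.1 ((hu2.comp hφ.tendsto_atTop).eventually hV)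
    refine eventually_atTop.2 ⟨m J, fun n hn => ?_⟩
    by_cases hr : ∃ j, m j = n
    · obtain ⟨j, rfl⟩ := hr
      rw [hζm]
      exact hJ j (hm.le_iff_le.1 hn)
    · rw [hζdef, Function.extend_apply' _ _ _ hr]
      exact mem_of_mem_nhds hV
  have := (h ζ hζ).comp hm.tendsto_atTop
  simpa only [Function.comp_def, hζm] using this

/-! ### Suprema, infima and discounted sums -/

theorem TendstoUniformly.tendsto_iSup_abs_sub {A I : Type*} {l : Filter A} {F : A → I → ℝ}
    {G : I → ℝ} (h : TendstoUniformly F G l) :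
    Tendsto (fun a => ⨆ i, |F a i - G i|) l (𝓝 0) := by
  rw [Metric.tendsto_nhds]
  intro ε hε
  filter_upwards [Metric.tendstoUniformly_iff.1 h (ε / 2) (half_pos hε)] with a ha
  rw [Real.dist_0_eq_abs, abs_of_nonneg (Real.iSup_nonneg fun i => abs_nonneg _)]
  refine (Real.iSup_le (fun i => ?_) (half_pos hε).le).trans_lt (half_lt_self hε)
  rw [← Real.dist_eq, dist_comm]
  exact (ha i).le

theorem bddAbove_range_abs_sub {I : Type*} {f g : I → ℝ} {C D : ℝ} (hf : ∀ i, |f i| ≤ C)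
    (hg : ∀ i, |g i| ≤ D) : BddAbove (range fun i => |f i - g i|) := by
  refine ⟨C + D, ?_⟩
  rintro _ ⟨i, rfl⟩
  exact (abs_sub _ _).trans (add_le_add (hf i) (hg i))

theorem bddBelow_range_of_abs_le {I : Type*} {f : I → ℝ} {C : ℝ} (hf : ∀ i, |f i| ≤ C) :
    BddBelow (range f) := by
  refine ⟨-C, ?_⟩
  rintro _ ⟨i, rfl⟩
  exact (abs_le.1 (hf i)).1

theorem abs_ciInf_sub_ciInf_le {I : Type*} {f g : I → ℝ} (hf : BddBelow (range f))
    (hg : BddBelow (range g)) (hfg : BddAbove (range fun i => |f i - g i|)) :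
    |(⨅ i, f i) - ⨅ i, g i| ≤ ⨆ i, |f i - g i| := by
  -- Over an empty index the real infima and supremum all take the default value `0`.
  rcases isEmpty_or_nonempty I with hI | hI
  · simp
  have h1 : (⨅ i, f i) - (⨆ i, |f i - g i|) ≤ ⨅ i, g i := le_ciInf fun i => by
    linarith [ciInf_le hf i, le_ciSup hfg i, (abs_le.1 (le_refl |f i - g i|)).2]
  have h2 : (⨅ i, g i) - (⨆ i, |f i - g i|) ≤ ⨅ i, f i := le_ciInf fun i => by
    linarith [ciInf_le hg i, le_ciSup hfg i, (abs_le.1 (le_refl |f i - g i|)).1]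
  exact abs_le.2 ⟨by linarith, by linarith⟩

theorem summable_discounted {β C : ℝ} (hβ : β ∈ Ioo (0 : ℝ) 1) {e : ℕ → ℝ}
    (he : ∀ k, |e k| ≤ C) : Summable fun k => β ^ k * e k := by
  refine Summable.of_norm_bounded ((summable_geometric_of_lt_one hβ.1.le hβ.2).mul_right C)
    fun k => ?_
  rw [norm_mul, norm_pow, Real.norm_of_nonneg hβ.1.le]
  exact mul_le_mul_of_nonneg_left (he k) (pow_nonneg hβ.1.le k)

theorem abs_tsum_discounted_le {β : ℝ} (hβ : β ∈ Ioo (0 : ℝ) 1) {e b : ℕ → ℝ} {C : ℝ}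
    (heb : ∀ k, |e k| ≤ b k) (hb : ∀ k, |b k| ≤ C) :
    |∑' k, β ^ k * e k| ≤ ∑' k, β ^ k * b k := by
  refine tsum_of_norm_bounded (f := fun k => β ^ k * e k) (summable_discounted hβ hb).hasSum
    fun k => ?_
  rw [norm_mul, norm_pow, Real.norm_of_nonneg hβ.1.le]
  exact mul_le_mul_of_nonneg_left (heb k) (pow_nonneg hβ.1.le k)

/-- Uniform convergence of bounded stage costs implies uniform convergence of the discounted
sums. -/
theorem tendstoUniformly_tsum_discounted {A I : Type*} {l : Filter A} {β C : ℝ}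
    (hβ : β ∈ Ioo (0 : ℝ) 1) (hC : 0 ≤ C) {f : A → ℕ → I → ℝ} {g : ℕ → I → ℝ}
    (hf : ∀ a k i, |f a k i| ≤ C) (hg : ∀ k i, |g k i| ≤ C)
    (h : ∀ k, TendstoUniformly (fun a i => f a k i) (g k) l) :
    TendstoUniformly (fun a i => ∑' k, β ^ k * f a k i) (fun i => ∑' k, β ^ k * g k i) l := by
  have hbdd : ∀ a k, BddAbove (range fun i => |f a k i - g k i|) := fun a k =>
    bddAbove_range_abs_sub (hf a k) (hg k)
  have hD0 : ∀ a k, 0 ≤ ⨆ i, |f a k i - g k i| := fun a k =>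
    Real.iSup_nonneg fun i => abs_nonneg _
  have hDC : ∀ a k, |⨆ i, (|f a k i - g k i|)| ≤ C + C := fun a k => by
    rw [abs_of_nonneg (hD0 a k)]
    exact Real.iSup_le (fun i => (abs_sub _ _).trans (add_le_add (hf a k i) (hg k i)))
      (by positivity)
  -- Taking the supremum over `i` before summing makes the bound independent of `i`. Each term tends
  -- to `0` and is dominated by `β ^ k * (C + C)`, so dominated convergence for series applies.
  have hlim : Tendsto (fun a => ∑' k, β ^ k * ⨆ i, |f a k i - g k i|) l (𝓝 0) := by
    have := tendsto_tsum_of_dominated_convergence (𝓕 := l)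
      (f := fun a k => β ^ k * ⨆ i, |f a k i - g k i|) (g := fun _ => 0)
      ((summable_geometric_of_lt_one hβ.1.le hβ.2).mul_right (C + C))
      (fun k => by simpa using ((h k).tendsto_iSup_abs_sub).const_mul (β ^ k))
      (Eventually.of_forall fun a k => by
        rw [norm_mul, norm_pow, Real.norm_of_nonneg hβ.1.le]
        exact mul_le_mul_of_nonneg_left (hDC a k) (pow_nonneg hβ.1.le k))
    rwa [tsum_zero] at this
  rw [Metric.tendstoUniformly_iff]
  intro ε hε
  filter_upwards [hlim.eventually (gt_mem_nhds hε)] with a ha i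
  rw [dist_comm, Real.dist_eq, ← (summable_discounted hβ fun k => hf a k i).tsum_sub
    (summable_discounted hβ fun k => hg k i)]
  simp_rw [← mul_sub]
  exact (abs_tsum_discounted_le hβ (fun k => le_ciSup (hbdd a k) i) (hDC a)).trans_lt ha

/-! ### The discounted cost as a series of stage costs -/

section DiscountedCost

variable {X Y U : Type*} [MeasurableSpace X] [MeasurableSpace Y] [MeasurableSpace U]

/-- The discounted cost is the discounted sum of the expected stage costs. -/
theorem discountedCost_eq_tsum {β C : ℝ} (hβ : β ∈ Ioo (0 : ℝ) 1) {c : X × U → ℝ}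
    (hc : Measurable c) (hcC : ∀ z, |c z| ≤ C) (Q : Kernel X Y) [IsMarkovKernel Q]
    (P : Measure X) [IsProbabilityMeasure P] (S : Kernel (X × U) X) [IsMarkovKernel S]
    (γ : AdmissiblePolicy Y U) :
    discountedCost β c Q P S γ =
      ∑' k, β ^ k * ∫ ω, c ((ω k).1.1, (ω k).2) ∂(processLaw P S Q γ) := by
  simp_rw [← integral_const_mul]
  have hm : ∀ k, Measurable fun ω : ℕ → (X × Y) × U => β ^ k * c ((ω k).1.1, (ω k).2) :=
    fun k => (hc.comp (by fun_prop)).const_mul _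
  have hsum := (summable_geometric_of_lt_one hβ.1.le hβ.2).mul_right C
  exact (hasSum_integral_of_dominated_convergence (fun k _ => β ^ k * C)
    (fun k => (hm k).aestronglyMeasurable)
    (fun k => Eventually.of_forall fun ω => by
      rw [norm_mul, norm_pow, Real.norm_of_nonneg hβ.1.le]
      exact mul_le_mul_of_nonneg_left (hcC _) (pow_nonneg hβ.1.le k))
    (Eventually.of_forall fun ω => hsum) (integrable_const _)
    (Eventually.of_forall fun ω =>
      (summable_discounted hβ fun k => hcC ((ω k).1.1, (ω k).2)).hasSum)).tsum_eq.symm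

theorem abs_discountedCost_le {β C : ℝ} (hβ : β ∈ Ioo (0 : ℝ) 1) {c : X × U → ℝ}
    (hc : Measurable c) (hcC : ∀ z, |c z| ≤ C) (Q : Kernel X Y) [IsMarkovKernel Q]
    (P : Measure X) [IsProbabilityMeasure P] (S : Kernel (X × U) X) [IsMarkovKernel S]
    (γ : AdmissiblePolicy Y U) : |discountedCost β c Q P S γ| ≤ ∑' k, β ^ k * C := by
  rw [discountedCost_eq_tsum hβ hc hcC]
  exact abs_tsum_discounted_le hβ (fun k => abs_integral_le_of_abs_le fun ω => hcC _)
    fun _ => le_rfl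

end DiscountedCost

/-! ### Uniform convergence over policies -/

section Robustness

variable {X Y U : Type*} [PseudoMetricSpace X] [SecondCountableTopology X] [MeasurableSpace X]
  [OpensMeasurableSpace X] [MeasurableSpace Y] [TopologicalSpace U] [CompactSpace U]
  [MeasurableSpace U]

/-- Under continuous convergence of the transition kernels the expected cost at each time converges
uniformly over all policies. -/
theorem tendstoUniformly_integral_cost {c : X × U → ℝ} {C : ℝ} (hC : 0 ≤ C) (hc : Continuous c)
    (hcm : Measurable c) (hcC : ∀ z, |c z| ≤ C) {Q : Kernel X Y} [IsMarkovKernel Q]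
    (hQ : ∀ x, Tendsto (fun x' => tvDist (Q x') (Q x)) (𝓝 x) (𝓝 0))
    (P : Measure X) [IsProbabilityMeasure P]
    {T : Kernel (X × U) X} [IsMarkovKernel T] {Tn : ℕ → Kernel (X × U) X}
    [∀ n, IsMarkovKernel (Tn n)]
    (hT : ∀ z, Tendsto (fun p : ℕ × (X × U) => kernelLaw (Tn p.1) p.2) (atTop ×ˢ 𝓝 z)
      (𝓝 (kernelLaw T z))) (k : ℕ) :
    TendstoUniformly (fun n (γ : AdmissiblePolicy Y U) =>
        ∫ ω, c ((ω k).1.1, (ω k).2) ∂(processLaw P (Tn n) Q γ))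
      (fun γ => ∫ ω, c ((ω k).1.1, (ω k).2) ∂(processLaw P T Q γ)) atTop := by
  simp_rw [integral_cost_eq hcm hcC]
  have hm : ∀ (S : Kernel (X × U) X) [IsMarkovKernel S] (γ : AdmissiblePolicy Y U),
      Measurable fun p : X × Y => costToGo c S Q γ k 0
        (fun _ => p.2, fun _ => γ.act 0 (fun _ => p.2, Fin.elim0))
        (p.1, γ.act 0 (fun _ => p.2, Fin.elim0)) := fun S _ γ => by
    have := γ.measurable_act 0
    exact (measurable_costToGo hcm γ k 0).comp
      (f := fun p : X × Y => (((fun _ => p.2, fun _ => γ.act 0 (fun _ => p.2, Fin.elim0)),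
        (p.1, γ.act 0 (fun _ => p.2, Fin.elim0))) : PastInfo Y U 0 × (X × U))) (by fun_prop)
  -- The initial law does not vary, so the integral limit theorem is used with a constant family of
  -- measures; only the integrand converges.
  refine tendstoUniformly_integral_of_tendsto (μs := fun _ => ⟨P, inferInstance⟩)
    (μ := ⟨P, inferInstance⟩) tendsto_const_nhds hC
    (fun n γ => ((hm (Tn n) γ).stronglyMeasurable.integral_kernel_prod_right').measurable)
    (fun γ => ((hm T γ).stronglyMeasurable.integral_kernel_prod_right').measurable)
    (fun n γ x => abs_integral_le_of_abs_le fun y => abs_costToGo_le hcC _ _ _ _ _)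
    (fun γ x => abs_integral_le_of_abs_le fun y => abs_costToGo_le hcC _ _ _ _ _)
    fun x => ?_
  exact TendstoUniformly.integral_channel hQ
    (H := fun n (i : AdmissiblePolicy Y U × PastInfo Y U 0) z =>
      costToGo c (Tn n) Q i.1 k 0 i.2 z)
    (H₀ := fun i z => costToGo c T Q i.1 k 0 i.2 z)
    (τ := fun (γ : AdmissiblePolicy Y U) y =>
      (γ, (fun _ => y, fun _ => γ.act 0 (fun _ => y, Fin.elim0))))
    (α := fun γ y => γ.act 0 (fun _ => y, Fin.elim0)) hC
    (fun n γ x => (hm (Tn n) γ).comp measurable_prodMk_left)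
    (fun γ x => (hm T γ).comp measurable_prodMk_left)
    (fun n i z => abs_costToGo_le hcC _ _ _ _ _)
    (fun i z => abs_costToGo_le hcC _ _ _ _ _)
    (tendstoUniformly_costToGo hC hc hcm hcC hQ hT k 0) x

theorem tendstoUniformly_discountedCost {c : X × U → ℝ} {C : ℝ} (hC : 0 ≤ C) (hc : Continuous c)
    (hcm : Measurable c) (hcC : ∀ z, |c z| ≤ C) {Q : Kernel X Y} [IsMarkovKernel Q]
    (hQ : ∀ x, Tendsto (fun x' => tvDist (Q x') (Q x)) (𝓝 x) (𝓝 0))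
    (P : Measure X) [IsProbabilityMeasure P]
    {T : Kernel (X × U) X} [IsMarkovKernel T] {Tn : ℕ → Kernel (X × U) X}
    [∀ n, IsMarkovKernel (Tn n)]
    (hT : ∀ z, Tendsto (fun p : ℕ × (X × U) => kernelLaw (Tn p.1) p.2) (atTop ×ˢ 𝓝 z)
      (𝓝 (kernelLaw T z))) {β : ℝ} (hβ : β ∈ Ioo (0 : ℝ) 1) :
    TendstoUniformly (fun n γ => discountedCost β c Q P (Tn n) γ)
      (fun γ => discountedCost β c Q P T γ) atTop := by
  simp_rw [discountedCost_eq_tsum hβ hcm hcC]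
  exact tendstoUniformly_tsum_discounted hβ hC
    (fun n k γ => abs_integral_le_of_abs_le fun ω => hcC _)
    (fun k γ => abs_integral_le_of_abs_le fun ω => hcC _)
    (tendstoUniformly_integral_cost hC hc hcm hcC hQ P hT)

end Robustness

/-! ### The robustness theorem -/

theorem mainTheorem4 {dX dY dU : ℕ}
    (𝕏 : Set (EuclideanSpace ℝ (Fin dX))) (h𝕏 : MeasurableSet 𝕏)
    (𝕐 : Set (EuclideanSpace ℝ (Fin dY))) (h𝕐 : MeasurableSet 𝕐)
    (𝕌 : Set (EuclideanSpace ℝ (Fin dU))) (h𝕌 : IsCompact 𝕌)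
    (P : Measure 𝕏) [IsProbabilityMeasure P]
    (Q : Kernel 𝕏 𝕐) [IsMarkovKernel Q]
    (T : Kernel (𝕏 × 𝕌) 𝕏) [IsMarkovKernel T]
    (Tn : ℕ → Kernel (𝕏 × 𝕌) 𝕏) [∀ n, IsMarkovKernel (Tn n)]
    (c : 𝕏 × 𝕌 → ℝ) (β : ℝ) (hβ : β ∈ Ioo (0 : ℝ) 1)
    (hT : Continuous fun z : 𝕏 × 𝕌 => kernelLaw T z)
    (hQ : ∀ (x : ℕ → 𝕏) (x₀ : 𝕏), Tendsto x atTop (𝓝 x₀) →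
      Tendsto (fun k => tvDist (Q (x k)) (Q x₀)) atTop (𝓝 0))
    (hc : Continuous c) (hcb : ∃ C : ℝ, ∀ z, |c z| ≤ C)
    (hTn : ∀ (z : ℕ → 𝕏 × 𝕌) (z₀ : 𝕏 × 𝕌), Tendsto z atTop (𝓝 z₀) →
      Tendsto (fun n => kernelLaw (Tn n) (z n)) atTop (𝓝 (kernelLaw T z₀))) :
    -- the supremum and the infima below are taken over bounded families
    ((∀ n, BddAbove (range fun γ : AdmissiblePolicy 𝕐 𝕌 =>
        |discountedCost β c Q P (Tn n) γ - discountedCost β c Q P T γ|)) ∧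
      (∀ n, BddBelow (range fun γ : AdmissiblePolicy 𝕐 𝕌 => discountedCost β c Q P (Tn n) γ)) ∧
      BddBelow (range fun γ : AdmissiblePolicy 𝕐 𝕌 => discountedCost β c Q P T γ)) ∧
    -- uniform convergence of the costs over all admissible policies
    Tendsto (fun n => ⨆ γ : AdmissiblePolicy 𝕐 𝕌,
      |discountedCost β c Q P (Tn n) γ - discountedCost β c Q P T γ|) atTop (𝓝 0) ∧
    -- convergence of the optimal costs
    Tendsto (fun n => |optimalCost β c Q P (Tn n) - optimalCost β c Q P T|) atTop (𝓝 0) := by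

  obtain ⟨C, hC⟩ := hcb
  have hcC : ∀ z, |c z| ≤ |C| := fun z => (hC z).trans (le_abs_self C)
  have : CompactSpace 𝕌 := isCompact_iff_compactSpace.1 h𝕌
  have hcm : Measurable c := hc.measurable
  have hQ' : ∀ x, Tendsto (fun x' => tvDist (Q x') (Q x)) (𝓝 x) (𝓝 0) := fun x =>
    tendsto_of_seq_tendsto fun u hu => hQ u x hu
  have hbdd : ∀ (S : Kernel (𝕏 × 𝕌) 𝕏) [IsMarkovKernel S] (γ : AdmissiblePolicy 𝕐 𝕌),
      |discountedCost β c Q P S γ| ≤ ∑' k, β ^ k * |C| := fun S _ γ =>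
    abs_discountedCost_le hβ hcm hcC Q P S γ
  have hsup := (tendstoUniformly_discountedCost (abs_nonneg C) hc hcm hcC hQ' P
    (fun z => tendsto_atTop_prod_nhds_of_seq fun ζ hζ => hTn ζ z hζ) hβ).tendsto_iSup_abs_sub
  refine ⟨⟨fun n => bddAbove_range_abs_sub (hbdd (Tn n)) (hbdd T),
    fun n => bddBelow_range_of_abs_le (hbdd (Tn n)), bddBelow_range_of_abs_le (hbdd T)⟩, hsup, ?_⟩
  exact squeeze_zero (fun n => abs_nonneg _)
    (fun n => abs_ciInf_sub_ciInf_le (bddBelow_range_of_abs_le (hbdd (Tn n)))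
      (bddBelow_range_of_abs_le (hbdd T)) (bddAbove_range_abs_sub (hbdd (Tn n)) (hbdd T))) hsup
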